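/- Throughout, "graph" means a finite multigraph, possibly with loops, and $k,\ell$ are integers with $k\le\ell\le 2k-1$; $n$ denotes the number of vertices of $G$. A graph $G$ is \emph{$(k,\ell)$-sparse} if every subgraph with at least one edge, having $n'$ vertices and $m'$ edges, satisfies $m'\le kn'-\ell$; it is \emph{tight} if it is $(k,\ell)$-sparse and has exactly $kn-\ell$ edges. The \emph{$(k,\ell)$-pebble game with colors} on a finite vertex set starts with no edges and with $k$ pebbles on each vertex, one of each of the colors $c_1,\dots,c_k$. Its state is a directed multigraph with colored pebbles on its vertices and exactly one colored pebble on each of its edges. The moves are: \begin{itemize} \item \emph{Add-edge:} if the set $\{v,w\}$ carries in total at least $\ell+1$ pebbles and $v$ carries at least one, pick up a pebble from $v$, add a new directed edge $vw$ and put that pebble on it. \item \emph{Pebble-slide:} if $w$ carries a pebble $p$ and $vw$ is a directed edge, replace $vw$ by $wv$, put the pebble that was on $vw$ on $v$, and put $p$ on $wv$. \end{itemize} A graph $G$ is a \emph{pebble-game graph} if it is the underlying undirected graph of a state reachable by finitely many moves from the initial state on $V(G)$. An \emph{$\ell\mathsf{T}k$ decomposition} of $G$ is a decomposition of $G$ into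 $\ell$ edge-disjoint (not necessarily spanning, possibly single-vertex) trees $T_1,\dots,T_\ell$, which together contain all edges of $G$, such that each vertex of $G$ is in exactly $k$ of the trees. For a subgraph $G'$ of $G$, the \emph{tree-pieces} in $G'$ are the connected components of the graphs $T_i\cap G'$, $i=1,\dots,\ell$ (single vertices included; components coming from different trees count as different). The decomposition is \emph{proper} if every subgraph $G'$ of $G$ with at least two vertices contains at least $\ell$ tree-pieces, and $G$ is a \emph{proper $\ell\mathsf{T}k$} if it has a proper $\ell\mathsf{T}k$ decomposition. \textbf{Theorem.} Let $k\le\ell\le 2k-1$. A graph $G$ is a tight pebble-game graph if and only if it is a proper $\ell\mathsf{T}k$ with exactly $kn-\ell$ edges. -/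

import Mathlib

open scoped Graph

namespace PebbleGame

/-! Multigraphs, possibly with loops, are Mathlib's `Graph α β`, and `H ≤ G` says that `H` is a
subgraph of `G` (not necessarily induced). -/

section Sparsity

variable {α β : Type*}

/-- `G` is `(k, ℓ)`-sparse: every non-empty subgraph (that is, every subgraph with at least one
edge) with `n'` vertices and `m'` edges satisfies `m' ≤ k n' - ℓ`. -/
def IsSparse (k ℓ : ℕ) (G : Graph α β) : Prop :=
  ∀ H : Graph α β, H ≤ G → E(H).Nonempty →
    (E(H).ncard : ℤ) ≤ (k : ℤ) * (V(H).ncard : ℤ) - (ℓ : ℤ)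

/-- `G` has exactly `k n - ℓ` edges, where `n` is its number of vertices. The equation is between
integers, so it fails when `k n < ℓ`. -/
def HasTightCount (k ℓ : ℕ) (G : Graph α β) : Prop :=
  (E(G).ncard : ℤ) = (k : ℤ) * (V(G).ncard : ℤ) - (ℓ : ℤ)

/-- `G` is `(k, ℓ)`-tight: it is `(k, ℓ)`-sparse and has exactly `k n - ℓ` edges. -/
def IsTight (k ℓ : ℕ) (G : Graph α β) : Prop :=
  IsSparse k ℓ G ∧ HasTightCount k ℓ G

end Sparsity

section Game

/-- A configuration of the game: a directed multigraph whose edges carry one coloured pebble each,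
together with coloured pebbles on the vertices.

* `arc e = none`: the edge label `e` is not in use.
* `arc e = some (v, w, c)`: `e` is an edge directed from `v` to `w`, covered by a pebble of
  colour `c`.
* `peb v`: the multiset of the colours of the pebbles lying on the vertex `v`. -/
structure Config (α β : Type*) (k : ℕ) where
  arc : β → Option (α × α × Fin k)
  peb : α → Multiset (Fin k)

variable {α β : Type*} {k : ℕ}

open Classical in
/-- The initial configuration on the vertex set `X`: no edges, and on each vertex of `X` one pebble
of each of the `k` colours. -/
noncomputable def Config.init (X : Set α) : Config α β k where
  arc := fun _ => none
  peb := fun v => if v ∈ X then (Finset.univ : Finset (Fin k)).val else 0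

open Classical in
/-- The number of pebbles on the set `{v, w}` (counted once if `v = w`). -/
noncomputable def Config.pebblesOn (C : Config α β k) (v w : α) : ℕ :=
  ∑ x ∈ ({v, w} : Finset α), (C.peb x).card

open Classical in
/-- The pebble assignment obtained from `p` by picking up a pebble of colour `c` from `v`. -/
noncomputable def pickUp (p : α → Multiset (Fin k)) (v : α) (c : Fin k) :
    α → Multiset (Fin k) :=
  Function.update p v ((p v).erase c)

open Classical in
/-- The pebble assignment obtained from `p` by putting a pebble of colour `c` on `v`. -/
noncomputable def putDown (p : α → Multiset (Fin k)) (v : α) (c : Fin k) :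
    α → Multiset (Fin k) :=
  Function.update p v (c ::ₘ p v)

open Classical in
/-- The moves of the `(k, ℓ)`-pebble game with colours on the vertex set `X`. -/
inductive Move (ℓ : ℕ) (X : Set α) : Config α β k → Config α β k → Prop
  /-- *Add-edge*: `v` and `w` carry together at least `ℓ + 1` pebbles, one of which, of colour `c`,
  lies on `v`; it is picked up and put on the new edge `e`, directed from `v` to `w`. -/
  | addEdge (C : Config α β k) (e : β) (v w : α) (c : Fin k)
      (hv : v ∈ X) (hw : w ∈ X) (he : C.arc e = none)
      (hpeb : ℓ + 1 ≤ C.pebblesOn v w) (hc : c ∈ C.peb v) :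
      Move ℓ X C
        { arc := Function.update C.arc e (some (v, w, c))
          peb := pickUp C.peb v c }
  /-- *Pebble-slide*: a pebble of colour `c` lies on `w`, and `e` is an edge from `v` to `w` covered
  by a pebble of colour `d`. The edge is reversed and covered by the pebble from `w`, and the pebble
  that was on it is put on `v`. -/
  | slide (C : Config α β k) (e : β) (v w : α) (c d : Fin k)
      (he : C.arc e = some (v, w, d)) (hc : c ∈ C.peb w) :
      Move ℓ X C
        { arc := Function.update C.arc e (some (w, v, c))
          peb := putDown (pickUp C.peb w c) v d }

/-- `G` is the underlying undirected graph (on the vertex set of `G`) of the directed graph of the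
configuration `C`. -/
def Config.Underlies (C : Config α β k) (G : Graph α β) : Prop :=
  ∀ e x y, G.IsLink e x y ↔ ∃ c, C.arc e = some (x, y, c) ∨ C.arc e = some (y, x, c)

/-- `G` is a `(k, ℓ)`-pebble-game graph: a finite sequence of moves leads from the initial
configuration on the vertex set of `G` to one whose underlying undirected graph is `G`. -/
def IsPebbleGameGraph (k ℓ : ℕ) (G : Graph α β) : Prop :=
  ∃ C : Config α β k,
    Relation.ReflTransGen (Move ℓ V(G)) (Config.init V(G)) C ∧ C.Underlies G

end Game

section Trees

variable {α β : Type*}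

/-- `x` and `y` are joined by a walk in `G`. -/
def Reachable (G : Graph α β) (x y : α) : Prop :=
  Relation.ReflTransGen G.Adj x y

/-- `G` has a cycle: distinct vertices `v 0, …, v n` and distinct edges `e 0, …, e n`, where `e i`
joins `v i` and `v (i + 1)`, cyclically. A loop is a cycle (`n = 0`), and so is a pair of parallel
edges (`n = 1`). -/
def HasCycle (G : Graph α β) : Prop :=
  ∃ (n : ℕ) (v : Fin (n + 1) → α) (e : Fin (n + 1) → β),
    Function.Injective v ∧ Function.Injective e ∧ ∀ i, G.IsLink (e i) (v i) (v (i + 1))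

/-- A tree is a connected graph without cycles. It has at least one vertex, and may consist of a
single vertex. -/
structure IsTree (T : Graph α β) : Prop where
  nonempty : V(T).Nonempty
  connected : ∀ x ∈ V(T), ∀ y ∈ V(T), Reachable T x y
  acyclic : ¬ HasCycle T

/-- The connected components of `G`, each given by its vertex set. -/
def components (G : Graph α β) : Set (Set α) :=
  {K | ∃ x ∈ V(G), K = {y | Reachable G x y}}

/-- The family `T` is an `ℓTk` decomposition of `G`: the `T i` are `ℓ` pairwise edge-disjoint trees
in `G` which together contain all edges of `G`, and every vertex of `G` is in exactly `k` of them.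
The trees need not be spanning. -/
structure IsTreeDecomposition (k ℓ : ℕ) (G : Graph α β) (T : Fin ℓ → Graph α β) : Prop where
  le : ∀ i, T i ≤ G
  isTree : ∀ i, IsTree (T i)
  edgeDisjoint : ∀ i j, i ≠ j → Disjoint E(T i) E(T j)
  cover : ⋃ i, E(T i) = E(G)
  vertexCount : ∀ v ∈ V(G), {i | v ∈ V(T i)}.ncard = k

/-- The set of tree-pieces in the subgraph `H`: the components of the intersections `T i ⊓ H`.
A piece is recorded together with the index of the tree that it comes from, so that pieces of
different trees are different even when they have the same vertices. -/
def treePieces {ℓ : ℕ} (T : Fin ℓ → Graph α β) (H : Graph α β) : Set (Fin ℓ × Set α) :=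
  {p | p.2 ∈ components (T p.1 ⊓ H)}

/-- `G` is a proper `ℓTk`: it has an `ℓTk` decomposition for which every subgraph of `G` with at
least two vertices contains at least `ℓ` tree-pieces. (A single vertex always contains exactly `k`
of them.) -/
def IsProperTreeDecomposable (k ℓ : ℕ) (G : Graph α β) : Prop :=
  ∃ T : Fin ℓ → Graph α β, IsTreeDecomposition k ℓ G T ∧
    ∀ H : Graph α β, H ≤ G → 2 ≤ V(H).ncard → ℓ ≤ (treePieces T H).ncard

end Trees

end PebbleGame

/-! Given the tight count, both sides are equivalent to sparsity.

Each `T i ⊓ H` is a forest, so its components number its vertices minus its edges. Summing over `i`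
gives exactly `k n' - m'` tree-pieces in `H` (`IsTreeDecomposition.ncard_treePieces`). Having at
least `ℓ` pieces is therefore the sparsity bound; if `H` has no edges, `n' ≥ 2` already gives at
least `2k > ℓ` pieces.

A tight graph has a decomposition because sparsity with `k ≤ ℓ` implies the Nash-Williams condition
`|J| ≤ k (n - comps J)`. Hence the edges split into `k` forests (`IsSparse.exists_forests`),
obtained from a Rado-type list-shrinking argument. These forests have `k n - (k n - ℓ) = ℓ`
components in all, and every vertex lies in one component of each forest.

A sparse graph is played edge by edge (`IsSparse.isPebbleGameGraph`). Out-degree plus pebbles is `k`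
at every vertex. If the ends of the next edge carry at most `ℓ` pebbles and no other pebble is
reachable from them, the reachable set spans too many edges once the new edge is included; otherwise
a pebble can be slid to the ends. -/

namespace PebbleGame

/-! ### Walks, paths and cycles -/

section Paths

variable {α β : Type*}

/-- A chain of related elements can be shortened to one without repetitions. -/
lemma exists_injOn_path {r : α → α → Prop} {u v : α} (h : Relation.ReflTransGen r u v) :
    ∃ (n : ℕ) (f : ℕ → α), f 0 = u ∧ f n = v ∧ (∀ i < n, r (f i) (f (i + 1))) ∧
      Set.InjOn f (Set.Iic n) := by
  induction h with
  | refl =>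
    refine ⟨0, fun _ => u, rfl, rfl, by simp, ?_⟩
    intro a ha b hb _
    simp only [Set.mem_Iic, Nat.le_zero] at ha hb
    omega
  | @tail b c _ hbc ih =>
    obtain ⟨n, f, h0, hn, hr, hinj⟩ := ih
    by_cases hc : ∃ j ≤ n, f j = c
    · obtain ⟨j, hj, hjc⟩ := hc
      exact ⟨j, f, h0, hjc, fun i hi => hr i (by omega),
        hinj.mono (Set.Iic_subset_Iic.2 hj)⟩
    · push Not at hc
      refine ⟨n + 1, fun i => if i ≤ n then f i else c, by simp [h0], by simp, ?_, ?_⟩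
      · intro i hi
        rcases Nat.lt_succ_iff_lt_or_eq.1 hi with h | h
        · have h1 : i ≤ n := h.le
          have h2 : i + 1 ≤ n := h
          simpa [h1, h2] using hr i h
        · subst h
          simpa [hn] using hbc
      · intro a ha b hb hab
        simp only [Set.mem_Iic] at ha hb
        by_cases h1 : a ≤ n <;> by_cases h2 : b ≤ n <;> simp only [h1, h2, if_true, if_false] at hab
        · exact hinj h1 h2 hab
        · exact absurd hab (hc a h1)
        · exact absurd hab.symm (hc b h2)
        · omega

variable {G H : Graph α β} {x y z u v : α} {e : β}

lemma Reachable.symm (h : Reachable G x y) : Reachable G y x := by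
  have : Std.Symm G.Adj := ⟨fun _ _ h => h.symm⟩
  exact (Relation.ReflTransGen.stdSymm (r := G.Adj)).symm _ _ h

lemma Reachable.trans (h : Reachable G x y) (h' : Reachable G y z) : Reachable G x z :=
  Relation.ReflTransGen.trans h h'

lemma Reachable.mono (hle : H ≤ G) (h : Reachable H x y) : Reachable G x y :=
  Relation.ReflTransGen.mono (fun _ _ h => Graph.Adj.mono hle h) _ _ h

lemma reachable_of_isLink (h : G.IsLink e x y) : Reachable G x y :=
  Relation.ReflTransGen.single h.adj

lemma Reachable.right_mem (h : Reachable G x y) (hx : x ∈ V(G)) : y ∈ V(G) := by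
  induction h with
  | refl => exact hx
  | tail _ h _ => exact h.right_mem

lemma HasCycle.mono (hle : H ≤ G) (h : HasCycle H) : HasCycle G := by
  obtain ⟨n, v, e, hv, he, hl⟩ := h
  exact ⟨n, v, e, hv, he, fun i => (hl i).mono hle⟩

/-- An edge joining two vertices that are connected without it closes a cycle. -/
lemma hasCycle_restrict_insert {A : Set β} (he : G.IsLink e u v) (heA : e ∉ A)
    (h : Reachable (G.restrict A) u v) : HasCycle (G.restrict (insert e A)) := by
  obtain ⟨n, f, h0, hn, hr, hinj⟩ := exists_injOn_path h
  have : Nonempty β := ⟨e⟩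
  choose! g hg using hr
  have hgA : ∀ i < n, g i ∈ A := fun i hi => (hg i hi).1
  have hgl : ∀ i < n, G.IsLink (g i) (f i) (f (i + 1)) := fun i hi => (hg i hi).2
  -- The cycle is the path `f 0, …, f n` closed by `e`, which takes the last index; `n = 0` is the
  -- loop case.
  refine ⟨n, fun i => f i, fun i => if (i : ℕ) < n then g i else e, ?_, ?_, ?_⟩
  · intro a b hab
    exact Fin.ext (hinj (Nat.lt_succ_iff.1 a.2) (Nat.lt_succ_iff.1 b.2) hab)
  · intro a b hab
    have ha := a.2
    have hb := b.2
    apply Fin.ext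
    by_cases h1 : (a : ℕ) < n <;> by_cases h2 : (b : ℕ) < n <;>
      simp only [h1, h2, if_true, if_false] at hab
    · have l1 := hgl a h1
      have l2 := hgl b h2
      rw [← hab] at l2
      rcases l1.eq_and_eq_or_eq_and_eq l2 with ⟨h3, -⟩ | ⟨h3, h4⟩
      · exact hinj (Set.mem_Iic.2 (by omega)) (Set.mem_Iic.2 (by omega)) h3
      -- An edge traversed twice in opposite directions would force `a = b + 1` and `b = a + 1`.
      · have h5 := hinj (Set.mem_Iic.2 (by omega)) (Set.mem_Iic.2 (by omega)) h3
        have h6 := hinj (Set.mem_Iic.2 (by omega)) (Set.mem_Iic.2 (by omega)) h4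
        omega
    · exact absurd (hab ▸ hgA a h1) heA
    · exact absurd (hab ▸ hgA b h2) heA
    · omega
  · intro i
    by_cases hi : (i : ℕ) < n
    · have : ((i + 1 : Fin (n + 1)) : ℕ) = i + 1 := Fin.val_add_one_of_lt (by
        rw [Fin.lt_def]; simpa using hi)
      simp only [hi, if_true, this]
      exact ⟨Or.inr (hgA i hi), hgl i hi⟩
    · have hin : i = Fin.last n := Fin.ext (by simp; omega)
      subst hin
      simp only [Fin.val_last, lt_irrefl, if_false, Fin.last_add_one, Fin.val_zero]
      exact ⟨Or.inl rfl, by rw [hn, h0]; exact he.symm⟩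

/-- The ends of an edge of a cycle are connected without it. -/
lemma HasCycle.exists_reachable {A : Set β} (h : HasCycle (G.restrict A)) :
    ∃ e ∈ A, ∃ u v, G.IsLink e u v ∧ Reachable (G.restrict (A \ {e})) u v := by
  obtain ⟨n, f, g, hf, hg, hl⟩ := h
  refine ⟨g (Fin.last n), (hl _).1, f (Fin.last n), f 0, ?_, Reachable.symm ?_⟩
  · simpa using (hl (Fin.last n)).2
  -- The deleted edge is the one closing the cycle; the remaining edges form a path from `f 0` to `f
  -- n`.
  · have key : ∀ m (hm : m < n + 1),
        Reachable (G.restrict (A \ {g (Fin.last n)})) (f 0) (f ⟨m, hm⟩) := by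
      intro m
      induction m with
      | zero => intro _; exact Relation.ReflTransGen.refl
      | succ m ih =>
        intro hm
        refine (ih (by omega)).trans (reachable_of_isLink (e := g ⟨m, by omega⟩) ⟨⟨(hl _).1, ?_⟩, ?_⟩)
        · intro h
          have := congrArg Fin.val (hg h)
          simp at this
          omega
        · have h1 : (⟨m, by omega⟩ + 1 : Fin (n + 1)) = ⟨m + 1, hm⟩ := by
            apply Fin.ext
            rw [Fin.val_add_one_of_lt (by rw [Fin.lt_def]; simp; omega)]
          have := (hl ⟨m, by omega⟩).2
          rwa [h1] at this
    exact key n (by omega)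

end Paths

/-! ### Graphic rank by linear algebra -/

section Rank

variable {α β : Type*}

/-- The functions on the vertices of `G` that are constant along the edges in `A`. -/
def edgeConst (G : Graph α β) (A : Set β) : Submodule ℚ (V(G) → ℚ) where
  carrier := {f | ∀ e ∈ A, ∀ u v : V(G), G.IsLink e u v → f u = f v}
  add_mem' := by
    intro f g hf hg e he u v h
    simp [hf e he u v h, hg e he u v h]
  zero_mem' := by
    intro e _ u v _
    rfl
  smul_mem' := by
    intro c f hf e he u v h
    simp [hf e he u v h]

variable {G : Graph α β} {A B : Set β} {e : β} {u v : α}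

lemma mem_edgeConst {f : V(G) → ℚ} :
    f ∈ edgeConst G A ↔ ∀ e ∈ A, ∀ u v : V(G), G.IsLink e u v → f u = f v := Iff.rfl

/-- The number of components of the spanning subgraph of `G` with edges `A`, as a dimension. -/
noncomputable def comps (G : Graph α β) (A : Set β) : ℕ := Module.finrank ℚ (edgeConst G A)

lemma edgeConst_anti (h : A ⊆ B) : edgeConst G B ≤ edgeConst G A :=
  fun _ hf e he => hf e (h he)

lemma edgeConst_union : edgeConst G (A ∪ B) = edgeConst G A ⊓ edgeConst G B := by
  ext f
  simp only [Submodule.mem_inf, mem_edgeConst, Set.mem_union, or_imp, forall_and]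

lemma edgeConst_empty : edgeConst G ∅ = ⊤ := by
  ext f
  simp [mem_edgeConst]

lemma comps_empty (hV : V(G).Finite) : comps G ∅ = V(G).ncard := by
  have := hV.fintype
  rw [comps, edgeConst_empty, finrank_top, Module.finrank_fintype_fun_eq_card,
    ← Nat.card_eq_fintype_card, Nat.card_coe_set_eq]

lemma eq_of_reachable {f : V(G) → ℚ} (hf : f ∈ edgeConst G A) {u v : V(G)}
    (h : Reachable (G.restrict A) u v) : f u = f v := by
  obtain ⟨v, hv⟩ := v
  change Reachable _ _ v at h
  induction h with
  | refl => rfl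
  | @tail b c _ hbc ih =>
    obtain ⟨e, he, hl⟩ := hbc
    exact (ih hl.left_mem).trans (hf e he ⟨b, hl.left_mem⟩ ⟨c, hv⟩ hl)

open Classical in
lemma indicator_reachable_mem (u : α) :
    (fun x : V(G) => if Reachable (G.restrict A) u x then (1 : ℚ) else 0) ∈ edgeConst G A := by
  intro e he x y h
  have h' : Reachable (G.restrict A) x y := reachable_of_isLink (e := e) ⟨he, h⟩
  have : Reachable (G.restrict A) u x ↔ Reachable (G.restrict A) u y :=
    ⟨fun h1 => h1.trans h', fun h1 => h1.trans h'.symm⟩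
  simp [this]

/-- Functions constant along edges are the pullbacks along the quotient map `π` onto components, and
pulling back along a surjection is injective. -/
lemma ncard_components_restrict (hV : V(G).Finite) :
    (components (G.restrict A)).ncard = comps G A := by
  let π : V(G) → components (G.restrict A) := fun x =>
    ⟨{y | Reachable (G.restrict A) x y}, x, x.2, rfl⟩
  have hπ : ∀ x y, π x = π y ↔ Reachable (G.restrict A) x y := by
    intro x y
    constructor
    · intro h
      have : (y : α) ∈ (π y : Set α) := Relation.ReflTransGen.refl
      rw [← h] at this
      exact this
    · intro h
      apply Subtype.ext
      ext z
      exact ⟨fun h1 => h.symm.trans h1, fun h1 => h.trans h1⟩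
  have hsurj : Function.Surjective π := by
    rintro ⟨K, x, hx, rfl⟩
    exact ⟨⟨x, hx⟩, rfl⟩
  have := hV.fintype
  have hfin : Finite (components (G.restrict A)) := Finite.of_surjective π hsurj
  have := Fintype.ofFinite (components (G.restrict A))
  have hrange : LinearMap.range (LinearMap.funLeft ℚ ℚ π) = edgeConst G A := by
    apply le_antisymm
    · rintro _ ⟨g, rfl⟩ e he x y h
      simp only [LinearMap.funLeft_apply]
      rw [(hπ x y).2 (reachable_of_isLink (e := e) ⟨he, h⟩)]
    · intro f hf
      refine ⟨fun K => f (Function.surjInv hsurj K), ?_⟩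
      ext x
      simp only [LinearMap.funLeft_apply]
      exact eq_of_reachable hf ((hπ _ _).1 (Function.surjInv_eq hsurj _))
  rw [comps, ← hrange, LinearMap.finrank_range_of_inj
    (LinearMap.funLeft_injective_of_surjective ℚ ℚ π hsurj), Module.finrank_fintype_fun_eq_card,
    ← Nat.card_eq_fintype_card, Nat.card_coe_set_eq]

lemma comps_anti (hV : V(G).Finite) (h : A ⊆ B) : comps G B ≤ comps G A := by
  have := hV.to_subtype
  exact Submodule.finrank_mono (edgeConst_anti h)

/-- This is submodularity of the rank `n - comps`. It follows from the dimension formula for a sum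
and an intersection of subspaces: the intersection is the space of `A ∪ B`, and the sum lies in the
space of `A ∩ B`. -/
lemma comps_add_comps_le (hV : V(G).Finite) :
    comps G A + comps G B ≤ comps G (A ∪ B) + comps G (A ∩ B) := by
  have := hV.to_subtype
  have h := Submodule.finrank_sup_add_finrank_inf_eq (edgeConst G A) (edgeConst G B)
  have h1 : Module.finrank ℚ ↥(edgeConst G A ⊔ edgeConst G B) ≤ comps G (A ∩ B) :=
    Submodule.finrank_mono (sup_le (edgeConst_anti Set.inter_subset_left)
      (edgeConst_anti Set.inter_subset_right))
  rw [← edgeConst_union] at h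
  unfold comps at *
  omega

/-- One edge imposes a single linear equation `f u = f v`; a label outside `E(G)` imposes none. -/
lemma comps_singleton_add_one (hV : V(G).Finite) (e : β) : V(G).ncard ≤ comps G {e} + 1 := by
  have := hV.fintype
  by_cases he : e ∈ E(G)
  · obtain ⟨u, v, h⟩ := G.exists_isLink_of_mem_edgeSet he
    let φ : (V(G) → ℚ) →ₗ[ℚ] ℚ :=
      LinearMap.proj ⟨u, h.left_mem⟩ - LinearMap.proj ⟨v, h.right_mem⟩
    have hker : LinearMap.ker φ ≤ edgeConst G {e} := by
      intro f hf
      have hf' : f ⟨u, h.left_mem⟩ = f ⟨v, h.right_mem⟩ := by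
        simpa [φ, sub_eq_zero] using hf
      rintro _ rfl ⟨x, hx⟩ ⟨y, hy⟩ hxy
      rcases h.eq_and_eq_or_eq_and_eq hxy with ⟨rfl, rfl⟩ | ⟨rfl, rfl⟩
      · exact hf'
      · exact hf'.symm
    have h1 := Submodule.finrank_mono hker
    have h2 := LinearMap.finrank_range_add_finrank_ker φ
    have h3 := Submodule.finrank_le (LinearMap.range φ)
    rw [Module.finrank_self] at h3
    rw [Module.finrank_fintype_fun_eq_card, ← Nat.card_eq_fintype_card, Nat.card_coe_set_eq] at h2
    unfold comps
    omega
  · have : edgeConst G {e} = ⊤ := by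
      ext f
      simp only [Submodule.mem_top, iff_true]
      rintro _ rfl x y h
      exact absurd h.edge_mem he
    rw [comps, this, ← edgeConst_empty]
    exact (comps_empty hV).ge.trans (Nat.le_succ _)

lemma comps_le_comps_insert_add_one (hV : V(G).Finite) (e : β) (A : Set β) :
    comps G A ≤ comps G (insert e A) + 1 := by
  have h := comps_add_comps_le hV (A := {e}) (B := A)
  have h1 := comps_singleton_add_one hV e
  have h2 : comps G ({e} ∩ A) ≤ V(G).ncard := by
    rw [← comps_empty hV]
    exact comps_anti hV (Set.empty_subset _)
  rw [Set.singleton_union] at h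
  omega

lemma comps_insert_of_reachable (he : G.IsLink e u v) (h : Reachable (G.restrict A) u v) :
    comps G (insert e A) = comps G A := by
  have : edgeConst G (insert e A) = edgeConst G A := by
    refine le_antisymm (edgeConst_anti (Set.subset_insert _ _)) fun f hf => ?_
    rintro e' (rfl | he') x y hxy
    · rcases he.eq_and_eq_or_eq_and_eq hxy with ⟨h1, h2⟩ | ⟨h1, h2⟩
      · rw [h1, h2] at h
        exact eq_of_reachable hf h
      · rw [h1, h2] at h
        exact eq_of_reachable hf h.symm
    · exact hf e' he' x y hxy
  rw [comps, this, comps]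

/-- The indicator of the component of `u` is constant along `A` but separates `u` from `v`. -/
lemma comps_insert_lt (hV : V(G).Finite) (he : G.IsLink e u v)
    (h : ¬ Reachable (G.restrict A) u v) : comps G (insert e A) < comps G A := by
  classical
  have := hV.to_subtype
  apply Submodule.finrank_lt_finrank_of_lt
  refine lt_of_le_of_ne (edgeConst_anti (Set.subset_insert _ _)) fun heq => ?_
  have h1 := indicator_reachable_mem (G := G) (A := A) u
  rw [← heq] at h1
  have h2 := h1 e (Set.mem_insert _ _) ⟨u, he.left_mem⟩ ⟨v, he.right_mem⟩ he
  have h3 : Reachable (G.restrict A) u u := Relation.ReflTransGen.refl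
  simp [h, h3] at h2

lemma ncard_vertexSet_le_comps_add_card (hV : V(G).Finite) (A : Finset β) :
    V(G).ncard ≤ comps G A + A.card := by
  classical
  induction A using Finset.induction_on with
  | empty => simp [comps_empty hV]
  | insert e A he ih =>
    have := comps_le_comps_insert_add_one hV e A
    rw [Finset.card_insert_of_notMem he, Finset.coe_insert]
    omega

/-- A forest with `n` vertices and `m` edges has `n - m` components. -/
lemma comps_add_card_of_not_hasCycle (hV : V(G).Finite) (A : Finset β) (hA : ↑A ⊆ E(G))
    (hc : ¬ HasCycle (G.restrict A)) : comps G A + A.card = V(G).ncard := by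
  classical
  induction A using Finset.induction_on with
  | empty => simp [comps_empty hV]
  | insert e A he ih =>
    rw [Finset.coe_insert] at *
    have hle : G.restrict (A : Set β) ≤ G.restrict (insert e A) :=
      G.restrict_mono_right (Set.subset_insert _ _)
    have h1 := ih ((Set.subset_insert _ _).trans hA) fun h => hc (h.mono hle)
    obtain ⟨u, v, hl⟩ := G.exists_isLink_of_mem_edgeSet (hA (Set.mem_insert _ _))
    have h2 := comps_insert_lt hV hl fun h => hc (hasCycle_restrict_insert hl (by simpa using he) h)
    have h3 := comps_le_comps_insert_add_one hV e A
    rw [Finset.card_insert_of_notMem he]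
    omega

/-- A graph with `n` vertices, `m` edges and `n - m` components is a forest. -/
lemma not_hasCycle_of_comps_add_card (hV : V(G).Finite) (A : Finset β)
    (h : comps G A + A.card = V(G).ncard) : ¬ HasCycle (G.restrict A) := by
  classical
  intro hc
  obtain ⟨e, he, u, v, hl, hr⟩ := hc.exists_reachable
  have h1 := comps_insert_of_reachable hl hr
  rw [Set.insert_sdiff_singleton, Set.insert_eq_of_mem he] at h1
  -- Deleting a cycle edge keeps the components, so the general bound for `A.erase e` is violated by
  -- one.
  have h2 := ncard_vertexSet_le_comps_add_card hV (A.erase e)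
  rw [Finset.coe_erase, ← h1] at h2
  have h3 := Finset.card_erase_add_one (Finset.mem_coe.1 he)
  omega

end Rank

/-! ### Partition into independent sets -/

section Coloring

variable {β ι : Type*}

open Classical in
/-- If a list assignment satisfies Rado's condition for a submodular function `r`, and `e₀` has two
colours in its list, then one of the two can be deleted. -/
lemma rado_condition_delete [Fintype ι] [DecidableEq ι] (E : Finset β) (r : Finset β → ℤ)
    (hmono : ∀ A B, A ⊆ B → r A ≤ r B) (hsub : ∀ A B, r (A ∪ B) + r (A ∩ B) ≤ r A + r B)
    (L : β → Finset ι) (hL : ∀ J ⊆ E, (J.card : ℤ) ≤ ∑ c, r {e ∈ J | c ∈ L e})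
    {e₀ : β} {c₁ c₂ : ι} (hc : c₁ ≠ c₂) :
    (∀ J ⊆ E, (J.card : ℤ) ≤
      ∑ c, r {e ∈ J | c ∈ Function.update L e₀ ((L e₀).erase c₁) e}) ∨
    (∀ J ⊆ E, (J.card : ℤ) ≤
      ∑ c, r {e ∈ J | c ∈ Function.update L e₀ ((L e₀).erase c₂) e}) := by
  by_contra! h
  obtain ⟨⟨J₁, hJ₁, h₁⟩, ⟨J₂, hJ₂, h₂⟩⟩ := h
  have hmem : ∀ (c' : ι) (J : Finset β), J ⊆ E →
      ∑ c, r {e ∈ J | c ∈ Function.update L e₀ ((L e₀).erase c') e} < J.card → e₀ ∈ J := by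
    intro c' J hJ hlt
    by_contra hn
    refine absurd (hL J hJ) (not_le.2 ?_)
    refine (Finset.sum_congr rfl fun c _ => ?_).trans_lt hlt
    refine congrArg r (Finset.filter_congr fun e he => ?_)
    rw [Function.update_of_ne (by rintro rfl; exact hn he)]
  have m₁ := hmem c₁ J₁ hJ₁ h₁
  have m₂ := hmem c₂ J₂ hJ₂ h₂
  have hU := hL (J₁ ∪ J₂) (Finset.union_subset hJ₁ hJ₂)
  have hI := hL ((J₁ ∩ J₂).erase e₀)
    ((Finset.erase_subset _ _).trans (Finset.inter_subset_left.trans hJ₁))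
  have hcard := Finset.card_union_add_card_inter J₁ J₂
  have hcard' := Finset.card_erase_add_one (Finset.mem_inter.2 ⟨m₁, m₂⟩)
  -- Both violating sets contain `e₀`. By submodularity, the right side bounds the sums for the
  -- union and for the intersection without `e₀`. Rado's condition makes these at least `|J₁| + |J₂|
  -- - 1`, whereas the violations give at most `|J₁| + |J₂| - 2`.
  have key : ∑ c, r {e ∈ J₁ ∪ J₂ | c ∈ L e} + ∑ c, r {e ∈ (J₁ ∩ J₂).erase e₀ | c ∈ L e} ≤
      ∑ c, r {e ∈ J₁ | c ∈ Function.update L e₀ ((L e₀).erase c₁) e} +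
      ∑ c, r {e ∈ J₂ | c ∈ Function.update L e₀ ((L e₀).erase c₂) e} := by
    rw [← Finset.sum_add_distrib, ← Finset.sum_add_distrib]
    refine Finset.sum_le_sum fun c _ => le_trans (add_le_add (hmono _ _ ?_) (hmono _ _ ?_))
      (hsub _ _)
    -- As `c₁ ≠ c₂`, each colour in the list of `e₀` survives in at least one of the two shortened
    -- lists.
    · intro e he
      simp only [Finset.mem_filter, Finset.mem_union] at he ⊢
      by_cases hee : e = e₀
      · subst hee
        simp only [Function.update_self, Finset.mem_erase]
        by_cases hcc : c = c₁
        · subst hcc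
          exact Or.inr ⟨m₂, hc, he.2⟩
        · exact Or.inl ⟨m₁, hcc, he.2⟩
      · simp only [Function.update_of_ne hee]
        tauto
    · intro e he
      simp only [Finset.mem_filter, Finset.mem_inter, Finset.mem_erase] at he ⊢
      simp only [Function.update_of_ne he.1.1]
      tauto
  omega

open Classical in
/-- If `|J| ≤ k r(J)` for all `J ⊆ E`, where `r` is monotone, submodular and bounded by the
cardinality, then `E` can be coloured with `k` colours so that all colour classes are
independent. -/
lemma exists_coloring_of_card_le [Fintype ι] [DecidableEq ι] [Nonempty ι] (E : Finset β) (r : Finset β → ℤ)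
    (hmono : ∀ A B, A ⊆ B → r A ≤ r B) (hsub : ∀ A B, r (A ∪ B) + r (A ∩ B) ≤ r A + r B)
    (hcard : ∀ A, r A ≤ A.card) (hE : ∀ J ⊆ E, (J.card : ℤ) ≤ Fintype.card ι * r J) :
    ∃ f : β → ι, ∀ c, r {e ∈ E | f e = c} = ({e ∈ E | f e = c} : Finset β).card := by
  -- Full lists satisfy Rado's condition; lists of minimal total size that satisfy it have at most
  -- one colour each.
  have hex : ∃ n, ∃ L : β → Finset ι, (∀ J ⊆ E, (J.card : ℤ) ≤ ∑ c, r {e ∈ J | c ∈ L e}) ∧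
      ∑ e ∈ E, (L e).card = n := by
    refine ⟨_, fun _ => Finset.univ, fun J hJ => ?_, rfl⟩
    simpa using hE J hJ
  obtain ⟨L, hL, hn⟩ := Nat.find_spec hex
  have hone : ∀ e ∈ E, (L e).card ≤ 1 := by
    intro e he
    by_contra! h
    obtain ⟨c₁, hc₁, c₂, hc₂, hc⟩ := Finset.one_lt_card.1 h
    have hlt : ∀ c ∈ L e,
        ∑ e' ∈ E, (Function.update L e ((L e).erase c) e').card < Nat.find hex := by
      intro c hcL
      rw [← hn]
      refine Finset.sum_lt_sum (fun e' _ => ?_) ⟨e, he, ?_⟩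
      · by_cases hee : e' = e
        · subst hee
          simpa using Finset.card_le_card (Finset.erase_subset c (L e'))
        · rw [Function.update_of_ne hee]
      · simpa using Finset.card_erase_lt_of_mem hcL
    rcases rado_condition_delete E r hmono hsub L hL (e₀ := e) hc with h' | h'
    · exact Nat.find_min hex (hlt c₁ hc₁) ⟨_, h', rfl⟩
    · exact Nat.find_min hex (hlt c₂ hc₂) ⟨_, h', rfl⟩
  -- The default colour for empty lists only enlarges the classes, which is harmless since `r` is
  -- monotone.
  let f : β → ι := fun e => if h : (L e).Nonempty then h.choose else Classical.arbitrary ι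
  have hf : ∀ e ∈ E, ∀ c ∈ L e, f e = c := by
    intro e he c hc
    have h : (L e).Nonempty := ⟨c, hc⟩
    simp only [f, h, dite_true]
    exact Finset.card_le_one.1 (hone e he) _ h.choose_spec _ hc
  refine ⟨f, fun c => ?_⟩
  have h1 : ∑ c, r {e ∈ E | c ∈ L e} ≤ ∑ c, r {e ∈ E | f e = c} :=
    Finset.sum_le_sum fun c _ => hmono _ _ fun e he => by
      simp only [Finset.mem_filter] at he ⊢
      exact ⟨he.1, hf e he.1 c he.2⟩
  have h2 := hL E subset_rfl
  have h3 : (E.card : ℤ) = ∑ c, (({e ∈ E | f e = c} : Finset β).card : ℤ) := by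
    exact_mod_cast Finset.card_eq_sum_card_fiberwise (s := E) (t := Finset.univ) (f := f)
      (fun _ _ => Finset.mem_coe.2 (Finset.mem_univ _))
  -- `|E| ≤ ∑ r(class) ≤ ∑ |class| = |E|` forces equality in every class.
  refine (Finset.sum_eq_sum_iff_of_le (s := Finset.univ)
    (f := fun c => r {e ∈ E | f e = c}) fun c _ => hcard _).1 ?_ c (Finset.mem_univ c)
  refine le_antisymm (Finset.sum_le_sum fun c _ => hcard _) ?_
  rw [← h3]
  exact h2.trans h1

end Coloring

/-! ### Sparse graphs split into `k` forests -/

section NashWilliams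

variable {α β : Type*} {G : Graph α β} {k ℓ : ℕ}

open Classical in
/-- A `(k, ℓ)`-sparse graph with `k ≤ ℓ` satisfies the rank condition of the Nash-Williams
theorem. -/
lemma IsSparse.card_add_mul_comps_le (hkl : k ≤ ℓ) (hV : V(G).Finite) (hE : E(G).Finite)
    (hG : IsSparse k ℓ G) (J : Finset β) (hJ : ↑J ⊆ E(G)) :
    J.card + k * comps G J ≤ k * V(G).ncard := by
  let G' := G.restrict (J : Set β)
  let comp : α → Set α := fun x => {y | Reachable G' x y}
  have hcompeq : ∀ {x y}, Reachable G' x y → comp x = comp y := by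
    intro x y h
    ext z
    exact ⟨fun h1 => h.symm.trans h1, fun h1 => h.trans h1⟩
  have hCfin : (components G').Finite := by
    refine (hV.image comp).subset ?_
    rintro K ⟨x, hx, rfl⟩
    exact ⟨x, hx, rfl⟩
  rcases isEmpty_or_nonempty α with hα | hα
  · have h0 : E(G) = ∅ := Set.eq_empty_of_forall_notMem fun e he =>
      hα.elim (G.exists_isLink_of_mem_edgeSet he).choose
    rw [h0, Set.subset_empty_iff, Finset.coe_eq_empty] at hJ
    rw [hJ, Finset.coe_empty, comps_empty hV, Finset.card_empty, zero_add]
  have hend : ∀ e, ∃ x, e ∈ J → ∃ y, G.IsLink e x y := by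
    intro e
    by_cases he : e ∈ J
    · obtain ⟨x, y, h⟩ := G.exists_isLink_of_mem_edgeSet (hJ he)
      exact ⟨x, fun _ => ⟨y, h⟩⟩
    · exact ⟨hα.some, fun h => absurd h he⟩
  choose s hs using hend
  -- Each edge is assigned to the component of its chosen end `s e`, which reduces the claim to `m_K
  -- + k ≤ k |K|` for each component `K`.
  rw [← ncard_components_restrict hV, Set.ncard_eq_toFinset_card _ hCfin,
    Set.ncard_eq_toFinset_card _ hV,
    Finset.card_eq_sum_card_fiberwise (s := J) (t := hCfin.toFinset) (f := fun e => comp (s e))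
      (by
        intro e he
        obtain ⟨y, hy⟩ := hs e he
        simpa using ⟨s e, hy.left_mem, rfl⟩),
    Finset.card_eq_sum_card_fiberwise (s := hV.toFinset) (t := hCfin.toFinset) (f := comp)
      (by
        intro x hx
        simp only [Set.Finite.coe_toFinset] at hx ⊢
        exact ⟨x, hx, rfl⟩),
    Finset.mul_sum, Finset.card_eq_sum_ones, Finset.mul_sum, ← Finset.sum_add_distrib]
  refine Finset.sum_le_sum fun K hK => ?_
  simp only [Set.Finite.mem_toFinset] at hK
  obtain ⟨x₀, hx₀, rfl⟩ := hK
  have hsub : comp x₀ ⊆ V(G) := fun y hy => Reachable.right_mem (G := G') hy hx₀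
  have hcv : ({x ∈ hV.toFinset | comp x = comp x₀} : Finset α).card = (comp x₀).ncard := by
    rw [← Set.ncard_coe_finset]
    congr 1
    ext x
    simp only [Finset.coe_filter, Set.Finite.mem_toFinset, Set.mem_ofPred_eq]
    constructor
    · rintro ⟨-, h⟩
      rw [← h]
      exact Relation.ReflTransGen.refl
    · intro h
      exact ⟨hsub h, (hcompeq h).symm⟩
  rw [hcv]
  -- Without edges, `|K| ≥ 1` suffices; otherwise sparsity gives `m_K ≤ k |K| - ℓ ≤ k |K| - k`.
  rcases Finset.eq_empty_or_nonempty ({e ∈ J | comp (s e) = comp x₀} : Finset β) with h0 | ⟨e, he⟩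
  · rw [h0, Finset.card_empty, zero_add]
    refine Nat.mul_le_mul_left _ ?_
    exact Set.ncard_pos (hV.subset hsub) |>.2 ⟨x₀, Relation.ReflTransGen.refl⟩
  · let H := G'.induce (comp x₀)
    have hHG : H ≤ G := (Graph.induce_le (G := G') hsub).trans Graph.restrict_le
    have hmem : ∀ e ∈ ({e ∈ J | comp (s e) = comp x₀} : Finset β), e ∈ E(H) := by
      intro e he
      simp only [Finset.mem_filter] at he
      obtain ⟨y, hy⟩ := hs e he.1
      have hl : G'.IsLink e (s e) y := ⟨he.1, hy⟩
      have h1 : s e ∈ comp x₀ := by rw [← he.2]; exact Relation.ReflTransGen.refl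
      exact (show H.IsLink e (s e) y from
        ⟨hl, h1, Reachable.trans h1 (reachable_of_isLink hl)⟩).edge_mem
    have h1 := hG H hHG ⟨e, hmem e he⟩
    have h2 := Set.ncard_le_ncard (s := (({e ∈ J | comp (s e) = comp x₀} : Finset β) : Set β))
      (fun e he => hmem e he) (hE.subset hHG.edgeSet_mono)
    rw [Set.ncard_coe_finset] at h2
    have h3 : V(H) = comp x₀ := rfl
    rw [h3] at h1
    have h4 : (k : ℤ) ≤ ℓ := by exact_mod_cast hkl
    zify at h2 ⊢
    linarith

open Classical in
/-- The edges of a `(k, ℓ)`-sparse graph with `k ≤ ℓ` can be partitioned into `k` forests. -/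
lemma IsSparse.exists_forests (hk : 0 < k) (hkl : k ≤ ℓ) (hV : V(G).Finite) (hE : E(G).Finite)
    (hG : IsSparse k ℓ G) : ∃ f : β → Fin k, ∀ c,
      comps G {e ∈ E(G) | f e = c} + {e ∈ E(G) | f e = c}.ncard = V(G).ncard ∧
      ¬ HasCycle (G.restrict {e ∈ E(G) | f e = c}) := by
  have : Nonempty (Fin k) := ⟨⟨0, hk⟩⟩
  -- The colouring lemma is applied to the rank `n - comps`, for which independent sets are forests.
  have hcol : ∃ f : β → Fin k, ∀ c, (V(G).ncard : ℤ) -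
      comps G (({e ∈ hE.toFinset | f e = c} : Finset β) : Set β) =
        ({e ∈ hE.toFinset | f e = c} : Finset β).card := by
    refine exists_coloring_of_card_le (ι := Fin k) hE.toFinset
      (fun A => (V(G).ncard : ℤ) - comps G A) ?_ ?_ ?_ ?_
    · intro A B h
      have := comps_anti hV (G := G) (Finset.coe_subset.2 h)
      omega
    · intro A B
      have := comps_add_comps_le hV (A := (A : Set β)) (B := B)
      simp only [Finset.coe_union, Finset.coe_inter]
      omega
    · intro A
      have := ncard_vertexSet_le_comps_add_card hV A
      omega
    · intro J hJ
      have := hG.card_add_mul_comps_le hkl hV hE J (fun e he => by simpa using hJ he)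
      zify at this
      rw [Fintype.card_fin, mul_sub]
      linarith
  obtain ⟨f, hf⟩ := hcol
  refine ⟨f, fun c => ?_⟩
  have hset : (({e ∈ hE.toFinset | f e = c} : Finset β) : Set β) = {e ∈ E(G) | f e = c} := by
    ext e
    simp
  rw [← hset, Set.ncard_coe_finset]
  have h1 : comps G (({e ∈ hE.toFinset | f e = c} : Finset β) : Set β) +
      ({e ∈ hE.toFinset | f e = c} : Finset β).card = V(G).ncard := by
    have := hf c
    omega
  exact ⟨h1, not_hasCycle_of_comps_add_card hV _ h1⟩

end NashWilliams

/-! ### Tree-pieces and sparsity -/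

section TreeDecompositions

variable {α β : Type*} {k ℓ : ℕ} {G H : Graph α β}

lemma ncard_components_add_ncard_edgeSet (hV : V(G).Finite) (hE : E(G).Finite)
    (hc : ¬ HasCycle G) : (components G).ncard + E(G).ncard = V(G).ncard := by
  have h := comps_add_card_of_not_hasCycle hV hE.toFinset (by simp) (by simpa using hc)
  rwa [Set.Finite.coe_toFinset, ← ncard_components_restrict hV, Graph.restrict_self,
    ← Set.ncard_eq_toFinset_card _ hE] at h

lemma components_finite (hV : V(G).Finite) : (components G).Finite := by
  refine (hV.image fun x => {y | Reachable G x y}).subset ?_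
  rintro K ⟨x, hx, rfl⟩
  exact ⟨x, hx, rfl⟩

lemma ncard_setOf_snd_mem {ι γ : Type*} [Fintype ι] (S : ι → Set γ) (hS : ∀ i, (S i).Finite) :
    {p : ι × γ | p.2 ∈ S p.1}.ncard = ∑ i, (S i).ncard := by
  classical
  have : {p : ι × γ | p.2 ∈ S p.1} =
      ↑(Finset.univ.biUnion fun i => (hS i).toFinset.image fun x => (i, x)) := by
    ext ⟨i, x⟩
    simp
  rw [this, Set.ncard_coe_finset, Finset.card_biUnion]
  · refine Finset.sum_congr rfl fun i _ => ?_
    rw [Finset.card_image_of_injective _ (Prod.mk_right_injective i),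
      Set.ncard_eq_toFinset_card _ (hS i)]
  · intro i _ j _ hij
    rw [Function.onFun, Finset.disjoint_left]
    rintro ⟨a, x⟩ h1 h2
    simp only [Finset.mem_image, Prod.mk.injEq] at h1 h2
    obtain ⟨_, _, rfl, _⟩ := h1
    obtain ⟨_, _, rfl, _⟩ := h2
    exact hij rfl

/-- A subgraph with `n'` vertices and `m'` edges contains `k n' - m'` tree-pieces. -/
lemma IsTreeDecomposition.ncard_treePieces {T : Fin ℓ → Graph α β}
    (hT : IsTreeDecomposition k ℓ G T) (hV : V(G).Finite) (hE : E(G).Finite) (hH : H ≤ G) :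
    (treePieces T H).ncard + E(H).ncard = k * V(H).ncard := by
  classical
  have hVH : V(H).Finite := hV.subset hH.vertexSet_mono
  have hEH : E(H).Finite := hE.subset hH.edgeSet_mono
  have hVi : ∀ i, V(T i ⊓ H).Finite := fun i => hVH.subset Set.inter_subset_right
  have hEi : ∀ i, E(T i ⊓ H) = E(T i) ∩ E(H) := fun i =>
    (Graph.Compatible.of_le_le (hT.le i) hH).edgeSet_inf
  have hpieces : (treePieces T H).ncard = ∑ i, (components (T i ⊓ H)).ncard :=
    ncard_setOf_snd_mem _ fun i => components_finite (hVi i)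
  have hedges : E(H).ncard = ∑ i, E(T i ⊓ H).ncard := by
    rw [Set.ncard_eq_toFinset_card _ hEH]
    have : hEH.toFinset =
        Finset.univ.biUnion fun i => (hEH.subset ((hEi i).trans_subset Set.inter_subset_right)).toFinset := by
      ext e
      simp only [Set.Finite.mem_toFinset, Finset.mem_biUnion, Finset.mem_univ, true_and, hEi,
        Set.mem_inter_iff, exists_and_right]
      refine ⟨fun he => ⟨?_, he⟩, fun h => h.2⟩
      have := hH.edgeSet_mono he
      rwa [← hT.cover, Set.mem_iUnion] at this
    rw [this, Finset.card_biUnion]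
    · exact Finset.sum_congr rfl fun i _ => (Set.ncard_eq_toFinset_card _ _).symm
    · intro i _ j _ hij
      rw [Function.onFun, Finset.disjoint_left]
      intro e h1 h2
      simp only [Set.Finite.mem_toFinset, hEi] at h1 h2
      exact Set.disjoint_left.1 (hT.edgeDisjoint i j hij) h1.1 h2.1
  -- Double counting: each vertex of `H` lies in exactly `k` trees.
  have hverts : ∑ i, V(T i ⊓ H).ncard = k * V(H).ncard := by
    have h1 := Finset.sum_card_bipartiteAbove_eq_sum_card_bipartiteBelow
      (s := (Finset.univ : Finset (Fin ℓ))) (t := hVH.toFinset) (fun i v => v ∈ V(T i))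
    have h2 : ∀ i, V(T i ⊓ H).ncard =
        (Finset.bipartiteAbove (fun i v => v ∈ V(T i)) hVH.toFinset i).card := by
      intro i
      rw [← Set.ncard_coe_finset]
      congr 1
      ext v
      simp [and_comm]
    have h3 : ∀ v ∈ hVH.toFinset,
        (Finset.bipartiteBelow (fun i v => v ∈ V(T i)) (Finset.univ : Finset (Fin ℓ)) v).card = k := by
      intro v hv
      rw [← hT.vertexCount v (hH.vertexSet_mono (by simpa using hv)), ← Set.ncard_coe_finset]
      congr 1
      ext i
      simp
    rw [Finset.sum_congr rfl fun i _ => h2 i, h1, Finset.sum_congr rfl h3, Finset.sum_const,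
      ← Set.ncard_eq_toFinset_card _ hVH, smul_eq_mul, mul_comm]
  rw [hpieces, hedges, ← hverts, ← Finset.sum_add_distrib]
  refine Finset.sum_congr rfl fun i _ => ncard_components_add_ncard_edgeSet (hVi i) ?_ ?_
  · exact hEH.subset ((hEi i).trans_subset Set.inter_subset_right)
  · exact fun h => (hT.isTree i).acyclic (h.mono inf_le_left)

/-- A loop is a cycle. -/
lemma hasCycle_of_isLink_self {e : β} {x : α} (h : G.IsLink e x x) : HasCycle G :=
  ⟨0, fun _ => x, fun _ => e, fun a b _ => Subsingleton.elim (α := Fin 1) a b,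
    fun a b _ => Subsingleton.elim (α := Fin 1) a b, fun _ => h⟩

/-- A graph with a proper `ℓTk` decomposition is `(k, ℓ)`-sparse. -/
lemma IsProperTreeDecomposable.isSparse (h : IsProperTreeDecomposable k ℓ G)
    (hV : V(G).Finite) (hE : E(G).Finite) : IsSparse k ℓ G := by
  obtain ⟨T, hT, hprop⟩ := h
  intro H hH hne
  -- Properness speaks only of subgraphs with two vertices; an edge supplies them, since a loop
  -- would be a cycle in its tree.
  have h2 : 2 ≤ V(H).ncard := by
    obtain ⟨e, he⟩ := hne
    obtain ⟨x, y, hxy⟩ := H.exists_isLink_of_mem_edgeSet he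
    refine (Set.one_lt_ncard_iff (hV.subset hH.vertexSet_mono)).2
      ⟨x, y, hxy.left_mem, hxy.right_mem, ?_⟩
    rintro rfl
    have he' := hH.edgeSet_mono he
    rw [← hT.cover, Set.mem_iUnion] at he'
    obtain ⟨i, hi⟩ := he'
    exact (hT.isTree i).acyclic
      (hasCycle_of_isLink_self (((hT.le i).isLink_iff hi).2 (hxy.mono hH)))
  have h3 := hT.ncard_treePieces hV hE hH
  have h4 := hprop H hH h2
  zify at h3 h4
  linarith

/-- The tree-pieces of a decomposition of a `(k, ℓ)`-sparse graph make it proper. -/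
lemma IsTreeDecomposition.isProperTreeDecomposable {T : Fin ℓ → Graph α β}
    (hT : IsTreeDecomposition k ℓ G T) (hlk : (ℓ : ℤ) ≤ 2 * (k : ℤ) - 1) (hG : IsSparse k ℓ G)
    (hV : V(G).Finite) (hE : E(G).Finite) : IsProperTreeDecomposable k ℓ G := by
  refine ⟨T, hT, fun H hH h2 => ?_⟩
  have h3 := hT.ncard_treePieces hV hE hH
  rcases E(H).eq_empty_or_nonempty with h0 | hne
  · rw [h0, Set.ncard_empty, add_zero] at h3
    rw [h3]
    have := Nat.mul_le_mul_left k h2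
    omega
  · have h4 := hG H hH hne
    zify at h3 ⊢
    linarith

/-- The subgraph of `G` on a component of `G` is connected. -/
lemma reachable_induce_component {x y z : α} (hy : Reachable G x y)
    (hz : Reachable G x z) : Reachable (G.induce {w | Reachable G x w}) y z := by
  have key : ∀ w, Reachable G x w → Reachable (G.induce {w | Reachable G x w}) x w := by
    intro w hw
    induction hw with
    | refl => exact Relation.ReflTransGen.refl
    | @tail b c hb hbc ih =>
      obtain ⟨e, he⟩ := hbc
      exact ih.tail ⟨e, he, hb, Relation.ReflTransGen.tail hb he.adj⟩
  exact (key y hy).symm.trans (key z hz)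

lemma exists_fin_equiv_of_ncard {γ : Type*} {S : Set γ} {n : ℕ} (hS : S.Finite) (h : S.ncard = n) :
    Nonempty (Fin n ≃ S) := by
  have := hS.fintype
  refine ⟨(Fintype.equivFinOfCardEq ?_).symm⟩
  rw [← h, ← Nat.card_coe_set_eq, Nat.card_eq_fintype_card]

/-- The components of `k` forests partitioning the edges of a graph with `kn - ℓ` edges form an
`ℓTk` decomposition. -/
lemma exists_treeDecomposition_of_forests (hV : V(G).Finite) (hE : E(G).Finite)
    (hcount : HasTightCount k ℓ G) (f : β → Fin k)
    (hf : ∀ c, comps G {e ∈ E(G) | f e = c} + {e ∈ E(G) | f e = c}.ncard = V(G).ncard ∧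
      ¬ HasCycle (G.restrict {e ∈ E(G) | f e = c})) :
    ∃ T : Fin ℓ → Graph α β, IsTreeDecomposition k ℓ G T := by
  classical
  let F : Fin k → Graph α β := fun c => G.restrict {e ∈ E(G) | f e = c}
  -- The colour is recorded because components of different forests may have the same vertex set.
  let P : Set (Fin k × Set α) := {p | p.2 ∈ components (F p.1)}
  have hcf : ∀ c, (components (F c)).Finite := fun c => components_finite (G := F c) hV
  have hPfin : P.Finite := by
    refine (Set.finite_univ.prod (Set.finite_iUnion hcf)).subset ?_
    rintro ⟨c, K⟩ h
    exact ⟨trivial, Set.mem_iUnion.2 ⟨c, h⟩⟩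
  have hEsum : E(G).ncard = ∑ c, {e ∈ E(G) | f e = c}.ncard := by
    rw [Set.ncard_eq_toFinset_card _ hE, Finset.card_eq_sum_card_fiberwise (f := f)
      (t := Finset.univ) (fun _ _ => Finset.mem_coe.2 (Finset.mem_univ _))]
    refine Finset.sum_congr rfl fun c _ => ?_
    rw [← Set.ncard_coe_finset]
    congr 1
    ext e
    simp
  -- A forest with `m_c` edges has `n - m_c` components, and these add up to `k n - (k n - ℓ)`.
  have hPcard : P.ncard = ℓ := by
    have h1 : P.ncard = ∑ c, comps G {e ∈ E(G) | f e = c} := by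
      rw [show P.ncard = ∑ c, (components (F c)).ncard from ncard_setOf_snd_mem _ hcf]
      exact Finset.sum_congr rfl fun c _ => ncard_components_restrict hV
    have h2 := Finset.sum_congr (rfl : (Finset.univ : Finset (Fin k)) = Finset.univ)
      fun c _ => (hf c).1
    rw [Finset.sum_add_distrib, ← h1, ← hEsum, Finset.sum_const, Finset.card_univ,
      Fintype.card_fin, smul_eq_mul] at h2
    unfold HasTightCount at hcount
    zify at h2 ⊢
    linarith
  obtain ⟨σ⟩ := exists_fin_equiv_of_ncard hPfin hPcard
  have hσ : ∀ i, ∃ x ∈ V(G), (σ i).1.2 = {y | Reachable (F (σ i).1.1) x y} := fun i => (σ i).2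
  let T : Fin ℓ → Graph α β := fun i => (F (σ i).1.1).induce (σ i).1.2
  have hTF : ∀ i, T i ≤ F (σ i).1.1 := by
    intro i
    refine Graph.induce_le ?_
    obtain ⟨x, hx, h⟩ := hσ i
    rw [h]
    exact fun y hy => Reachable.right_mem hy hx
  have hunique : ∀ i j v, (σ i).1.1 = (σ j).1.1 → v ∈ (σ i).1.2 → v ∈ (σ j).1.2 → i = j := by
    intro i j v hc hi hj
    apply σ.injective
    apply Subtype.ext
    refine Prod.ext hc ?_
    obtain ⟨x, hx, h⟩ := hσ i
    obtain ⟨y, hy, h'⟩ := hσ j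
    rw [h] at hi ⊢
    rw [h'] at hj ⊢
    rw [hc] at hi ⊢
    have hxy : Reachable (F (σ j).1.1) x y := Reachable.trans hi (Reachable.symm hj)
    ext z
    exact ⟨fun hz => hxy.symm.trans hz, fun hz => hxy.trans hz⟩
  have hpiece : ∀ c, ∀ v ∈ V(G), ∃ i, (σ i).1.1 = c ∧ (σ i).1.2 = {y | Reachable (F c) v y} := by
    intro c v hv
    refine ⟨σ.symm ⟨(c, {y | Reachable (F c) v y}), v, hv, rfl⟩, ?_, ?_⟩ <;> simp
  refine ⟨T, ⟨fun i => (hTF i).trans Graph.restrict_le, fun i => ⟨?_, ?_, ?_⟩, ?_, ?_, ?_⟩⟩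
  · obtain ⟨x, hx, h⟩ := hσ i
    refine ⟨x, ?_⟩
    change x ∈ (σ i).1.2
    rw [h]
    exact Relation.ReflTransGen.refl
  · intro y hy z hz
    change y ∈ (σ i).1.2 at hy
    change z ∈ (σ i).1.2 at hz
    obtain ⟨x, hx, h⟩ := hσ i
    simp only [T]
    rw [h] at hy hz ⊢
    exact reachable_induce_component (G := F (σ i).1.1) hy hz
  · exact fun h => (hf _).2 (h.mono (hTF i))
  · intro i j hij
    rw [Set.disjoint_left]
    intro e hi hj
    obtain ⟨x, y, hxy⟩ := (T i).exists_isLink_of_mem_edgeSet hi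
    obtain ⟨x', y', hxy'⟩ := (T j).exists_isLink_of_mem_edgeSet hj
    have hc : (σ i).1.1 = (σ j).1.1 := by
      rw [← hxy.1.1.2, ← hxy'.1.1.2]
    rcases hxy.1.2.left_eq_or_eq hxy'.1.2 with rfl | rfl
    · exact hij (hunique i j x hc hxy.2.1 hxy'.2.1)
    · exact hij (hunique i j x hc hxy.2.1 hxy'.2.2)
  · apply Set.Subset.antisymm
    · exact Set.iUnion_subset fun i => ((hTF i).trans Graph.restrict_le).edgeSet_mono
    · intro e he
      obtain ⟨x, y, hxy⟩ := G.exists_isLink_of_mem_edgeSet he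
      obtain ⟨i, hi, hK⟩ := hpiece (f e) x hxy.left_mem
      rw [Set.mem_iUnion]
      refine ⟨i, (show (T i).IsLink e x y from ⟨?_, ?_, ?_⟩).edge_mem⟩
      · exact ⟨⟨he, hi.symm⟩, hxy⟩
      · rw [hK]
        exact Relation.ReflTransGen.refl
      · rw [hK]
        exact reachable_of_isLink (e := e) ⟨⟨he, rfl⟩, hxy⟩
  · intro v hv
    -- `g c` is the index of the component of `v` in forest `c`; `g` is injective, and its range is
    -- the set of trees through `v`.
    choose g hg1 hg2 using fun c => hpiece c v hv
    have : {i | v ∈ V(T i)} = Set.range g := by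
      ext i
      constructor
      · intro h
        refine ⟨(σ i).1.1, hunique _ i v (hg1 _) ?_ h⟩
        rw [hg2]
        exact Relation.ReflTransGen.refl
      · rintro ⟨c, rfl⟩
        change v ∈ (σ (g c)).1.2
        rw [hg2]
        exact Relation.ReflTransGen.refl
    rw [this, ← Set.image_univ, Set.ncard_image_of_injective, Set.ncard_univ, Nat.card_fin]
    intro a b hab
    rw [← hg1 a, hab, hg1]

/-- A `(k, ℓ)`-tight graph with `k ≤ ℓ < 2k` has a proper `ℓTk` decomposition. -/
lemma IsTight.isProperTreeDecomposable (hkl : k ≤ ℓ) (hlk : (ℓ : ℤ) ≤ 2 * (k : ℤ) - 1)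
    (hV : V(G).Finite) (hE : E(G).Finite) (hG : IsTight k ℓ G) :
    IsProperTreeDecomposable k ℓ G := by
  -- `0 < k` follows from `k ≤ ℓ ≤ 2k - 1`.
  obtain ⟨f, hf⟩ := hG.1.exists_forests (by omega) hkl hV hE
  obtain ⟨T, hT⟩ := exists_treeDecomposition_of_forests hV hE hG.2 f hf
  exact hT.isProperTreeDecomposable hlk hG.1 hV hE

end TreeDecompositions

/-! ### Playing the game on a sparse graph -/

section GameConstruction

variable {α β : Type*} {k ℓ : ℕ} {G : Graph α β}

open Classical in
/-- The edges in `A` that are directed out of `v`. -/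
noncomputable def Config.outEdges (C : Config α β k) (A : Finset β) (v : α) : Finset β :=
  {e ∈ A | ∃ w c, C.arc e = some (v, w, c)}

/-- `C` can be reached in the game and consists of the edges `A` of `G`; as in every state of the
game, the out-degree and the number of pebbles of every vertex add up to `k`. -/
structure Config.Realizes (ℓ : ℕ) (C : Config α β k) (G : Graph α β) (A : Finset β) : Prop where
  reachable : Relation.ReflTransGen (Move ℓ V(G)) (Config.init V(G)) C
  underlies : C.Underlies (G.restrict A)
  balance : ∀ v ∈ V(G), (C.outEdges A v).card + (C.peb v).card = k

lemma Config.pebblesOn_of_ne (C : Config α β k) {v w : α} (h : v ≠ w) :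
    C.pebblesOn v w = (C.peb v).card + (C.peb w).card := by
  classical
  exact Finset.sum_pair h

variable {C : Config α β k} {A : Finset β}

lemma Config.Realizes.arc_spec (hC : C.Realizes ℓ G A) {e : β} {v w : α} {c : Fin k}
    (h : C.arc e = some (v, w, c)) : e ∈ A ∧ G.IsLink e v w :=
  (hC.underlies e v w).2 ⟨c, Or.inl h⟩

lemma Config.Realizes.arc_eq_none (hC : C.Realizes ℓ G A) {e : β} (h : e ∉ A) :
    C.arc e = none := by
  rcases ha : C.arc e with _ | ⟨v, w, c⟩
  · rfl
  · exact absurd (hC.arc_spec ha).1 h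

lemma realizes_init (G : Graph α β) : (Config.init V(G) : Config α β k).Realizes ℓ G ∅ where
  reachable := Relation.ReflTransGen.refl
  underlies := by
    intro e x y
    simp [Config.init]
  balance := by
    intro v hv
    simp [Config.outEdges, Config.init, hv]

/-- Out-degrees and pebble counts of `v` and `w` change by opposite amounts, so the balance
persists. Leaving all other pebbles and arcs unchanged allows slides to be iterated along a path. -/
lemma Config.Realizes.slide (hC : C.Realizes ℓ G A) {e : β} {v w : α} {d : Fin k}
    (he : C.arc e = some (v, w, d)) (hvw : v ≠ w) (hw : 0 < (C.peb w).card) :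
    ∃ C' : Config α β k, C'.Realizes ℓ G A ∧ (C'.peb v).card = (C.peb v).card + 1 ∧
      (C'.peb w).card + 1 = (C.peb w).card ∧ (∀ x, x ≠ v → x ≠ w → C'.peb x = C.peb x) ∧
      ∀ e', e' ≠ e → C'.arc e' = C.arc e' := by
  classical
  obtain ⟨c, hc⟩ := Multiset.card_pos_iff_exists_mem.1 hw
  let C' : Config α β k :=
    { arc := Function.update C.arc e (some (w, v, c))
      peb := putDown (pickUp C.peb w c) v d }
  have hmove : Move ℓ V(G) C C' := Move.slide C e v w c d he hc
  have pv : (C'.peb v).card = (C.peb v).card + 1 := by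
    simp [C', putDown, pickUp, hvw]
  have pw : (C'.peb w).card + 1 = (C.peb w).card := by
    simp only [C', putDown, pickUp, Function.update_of_ne hvw.symm, Function.update_self]
    exact Multiset.card_erase_add_one hc
  have px : ∀ x, x ≠ v → x ≠ w → C'.peb x = C.peb x := by
    intro x h1 h2
    simp [C', putDown, pickUp, Function.update_of_ne, h1, h2]
  have harc : ∀ e', e' ≠ e → C'.arc e' = C.arc e' := fun e' h => Function.update_of_ne h _ _
  have harce : C'.arc e = some (w, v, c) := by simp [C']
  have heA := (hC.arc_spec he).1
  refine ⟨C', ⟨hC.reachable.tail hmove, ?_, ?_⟩, pv, pw, px, harc⟩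
  · intro e' x y
    rw [hC.underlies e' x y]
    by_cases h : e' = e
    · subst h
      rw [he, harce]
      simp only [Option.some.injEq, Prod.mk.injEq]
      constructor
      · rintro ⟨_, ⟨h1, h2, -⟩ | ⟨h1, h2, -⟩⟩
        · exact ⟨c, Or.inr ⟨h2, h1, rfl⟩⟩
        · exact ⟨c, Or.inl ⟨h2, h1, rfl⟩⟩
      · rintro ⟨_, ⟨h1, h2, -⟩ | ⟨h1, h2, -⟩⟩
        · exact ⟨d, Or.inr ⟨h2, h1, rfl⟩⟩
        · exact ⟨d, Or.inl ⟨h2, h1, rfl⟩⟩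
    · rw [harc e' h]
  · intro x hx
    have hb := hC.balance x hx
    by_cases hxv : x = v
    · subst hxv
      have h1 : C'.outEdges A x = (C.outEdges A x).erase e := by
        ext e'
        simp only [Config.outEdges, Finset.mem_erase, Finset.mem_filter]
        by_cases h : e' = e
        · subst h
          simp [harce, hvw.symm]
        · rw [harc e' h]
          tauto
      have h2 : e ∈ C.outEdges A x := Finset.mem_filter.2 ⟨heA, w, d, he⟩
      have h3 := Finset.card_erase_add_one h2
      rw [h1, pv]
      omega
    · by_cases hxw : x = w
      · subst hxw
        have h1 : C'.outEdges A x = insert e (C.outEdges A x) := by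
          ext e'
          simp only [Config.outEdges, Finset.mem_insert, Finset.mem_filter]
          by_cases h : e' = e
          · subst h
            simp [harce, heA]
          · rw [harc e' h]
            tauto
        have h2 : e ∉ C.outEdges A x := by
          simp [Config.outEdges, he, hvw]
        rw [h1, Finset.card_insert_of_notMem h2]
        omega
      · have h1 : C'.outEdges A x = C.outEdges A x := by
          refine Finset.filter_congr fun e' _ => ?_
          by_cases h : e' = e
          · subst h
            simp [harce, he, Ne.symm hxv, Ne.symm hxw]
          · rw [harc e' h]
        rw [h1, px x hxv hxw]
        exact hb

/-- Pebbles can be brought to `{v, w}` along a directed path. -/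
lemma Config.Realizes.gather_along {v w : α} (hvw : v ≠ w) (n : ℕ) (f : ℕ → α)
    (h0 : f 0 = v ∨ f 0 = w) (hn : f n ≠ v ∧ f n ≠ w) (hinj : Set.InjOn f (Set.Iic n))
    {C : Config α β k} (hC : C.Realizes ℓ G A)
    (hpath : ∀ i < n, ∃ e c, C.arc e = some (f i, f (i + 1), c))
    (hp : 0 < (C.peb (f n)).card) :
    ∃ C' : Config α β k, C'.Realizes ℓ G A ∧ C.pebblesOn v w < C'.pebblesOn v w := by
  induction n generalizing C with
  | zero => exact absurd h0 (by tauto)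
  | succ n ih =>
    obtain ⟨e, d, he⟩ := hpath n (Nat.lt_succ_self n)
    have hne : f n ≠ f (n + 1) := fun h => by
      have := hinj (Set.mem_Iic.2 (by omega)) (Set.mem_Iic.2 (by omega)) h
      omega
    -- Sliding over the last arc brings a pebble one step back towards `{v, w}`, without taking one
    -- from there.
    obtain ⟨C', hC', h1, -, h3, h4⟩ := hC.slide he hne hp
    by_cases hfn : f n = v ∨ f n = w
    · refine ⟨C', hC', ?_⟩
      rw [C.pebblesOn_of_ne hvw, C'.pebblesOn_of_ne hvw]
      rcases hfn with hfn | hfn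
      · rw [h3 w (by rw [hfn]; exact hvw.symm) hn.2.symm, ← hfn, h1]
        omega
      · rw [h3 v (by rw [hfn]; exact hvw) hn.1.symm, ← hfn, h1]
        omega
    · push Not at hfn
      obtain ⟨C'', hC'', hlt⟩ := ih hfn (hinj.mono (Set.Iic_subset_Iic.2 (Nat.le_succ n))) hC'
        (fun i hi => by
          obtain ⟨e', c, he'⟩ := hpath i (by omega)
          refine ⟨e', c, ?_⟩
          rw [h4, he']
          -- The reversed arc is not on the rest of the path, whose tails differ from `f n`.
          rintro rfl
          rw [he] at he'
          simp only [Option.some.injEq, Prod.mk.injEq] at he'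
          have := hinj (Set.mem_Iic.2 (by omega)) (Set.mem_Iic.2 (by omega)) he'.1
          omega)
        (by omega)
      refine ⟨C'', hC'', ?_⟩
      rw [C'.pebblesOn_of_ne hvw, h3 v hfn.1.symm hn.1.symm, h3 w hfn.2.symm hn.2.symm,
        ← C.pebblesOn_of_ne hvw] at hlt
      exact hlt

/-- If `{v, w}` carries at most `ℓ` pebbles and an edge `vw` can be added without violating
sparsity, then some vertex outside `{v, w}` that carries a pebble can be reached from `{v, w}`. -/
lemma Config.Realizes.exists_reachable_pebble (hV : V(G).Finite) (hE : E(G).Finite)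
    (hG : IsSparse k ℓ G) (hC : C.Realizes ℓ G A) {e₀ : β} {v w : α}
    (he₀ : G.IsLink e₀ v w) (he₀A : e₀ ∉ A) (hvw : v ≠ w) (hle : C.pebblesOn v w ≤ ℓ) :
    ∃ s x, (s = v ∨ s = w) ∧ (x ≠ v ∧ x ≠ w) ∧ 0 < (C.peb x).card ∧
      Relation.ReflTransGen (fun a b => ∃ e c, C.arc e = some (a, b, c)) s x := by
  classical
  by_contra! hno
  let r : α → α → Prop := fun a b => ∃ e c, C.arc e = some (a, b, c)
  let R : Set α := {x | Relation.ReflTransGen r v x ∨ Relation.ReflTransGen r w x}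
  have hvR : v ∈ R := Or.inl Relation.ReflTransGen.refl
  have hwR : w ∈ R := Or.inr Relation.ReflTransGen.refl
  have hclosed : ∀ a ∈ R, ∀ b, r a b → b ∈ R := by
    rintro a (h | h) b hab
    · exact Or.inl (h.tail hab)
    · exact Or.inr (h.tail hab)
  have hpath : ∀ a b, a ∈ V(G) → Relation.ReflTransGen r a b → b ∈ V(G) := by
    intro a b ha h
    induction h with
    | refl => exact ha
    | tail _ h _ =>
      obtain ⟨e, c, he⟩ := h
      exact (hC.arc_spec he).2.right_mem
  have hRV : R ⊆ V(G) := by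
    rintro x (h | h)
    · exact hpath v x he₀.left_mem h
    · exact hpath w x he₀.right_mem h
  have hRfin : R.Finite := hV.subset hRV
  -- By assumption the only pebbles in the reachable set `R` lie on `v` and `w`.
  have hpeb : ∑ x ∈ hRfin.toFinset, (C.peb x).card = C.pebblesOn v w := by
    symm
    refine Finset.sum_subset ?_ ?_
    · intro x hx
      simp only [Finset.mem_insert, Finset.mem_singleton] at hx
      rcases hx with rfl | rfl <;> simpa
    · intro x hx hx'
      simp only [Finset.mem_insert, Finset.mem_singleton, not_or] at hx'
      by_contra h
      rcases (by simpa using hx : x ∈ R) with h1 | h1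
      · exact hno v x (Or.inl rfl) hx' (Nat.pos_of_ne_zero h) h1
      · exact hno w x (Or.inr rfl) hx' (Nat.pos_of_ne_zero h) h1
  let B : Finset β := hRfin.toFinset.biUnion (C.outEdges A)
  have hB : B.card = ∑ x ∈ hRfin.toFinset, (C.outEdges A x).card := by
    refine Finset.card_biUnion fun x _ y _ hxy => ?_
    rw [Function.onFun, Finset.disjoint_left]
    intro e h1 h2
    obtain ⟨-, _, _, h1⟩ := Finset.mem_filter.1 h1
    obtain ⟨-, _, _, h2⟩ := Finset.mem_filter.1 h2
    rw [h1] at h2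
    simp only [Option.some.injEq, Prod.mk.injEq] at h2
    exact hxy h2.1
  -- Summing the balance over `R` gives `|B| ≥ k |R| - ℓ`. All arcs in `B` stay inside `R`, so
  -- adding `e₀` violates sparsity of `G.induce R`.
  have hsum : B.card + C.pebblesOn v w = k * R.ncard := by
    rw [hB, ← hpeb, ← Finset.sum_add_distrib, Set.ncard_eq_toFinset_card _ hRfin,
      Finset.sum_congr rfl fun x hx => hC.balance x (hRV (by simpa using hx)), Finset.sum_const,
      smul_eq_mul, mul_comm]
  have he₀B : e₀ ∉ B := by
    intro h
    obtain ⟨x, -, h⟩ := Finset.mem_biUnion.1 h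
    exact he₀A (Finset.mem_filter.1 h).1
  let H := G.induce R
  have hH : H ≤ G := Graph.induce_le hRV
  have hsub : ((insert e₀ B : Finset β) : Set β) ⊆ E(H) := by
    intro e he
    rcases Finset.mem_insert.1 (Finset.mem_coe.1 he) with rfl | he
    · exact (show H.IsLink e v w from ⟨he₀, hvR, hwR⟩).edge_mem
    · obtain ⟨x, hx, he⟩ := Finset.mem_biUnion.1 he
      obtain ⟨-, y, c, he⟩ := Finset.mem_filter.1 he
      have hxR : x ∈ R := by simpa using hx
      exact (show H.IsLink e x y from
        ⟨(hC.arc_spec he).2, hxR, hclosed x hxR y ⟨e, c, he⟩⟩).edge_mem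
  have h1 := Set.ncard_le_ncard hsub (hE.subset hH.edgeSet_mono)
  rw [Set.ncard_coe_finset, Finset.card_insert_of_notMem he₀B] at h1
  have h2 := hG H hH ⟨e₀, hsub (by simp)⟩
  rw [show V(H) = R from rfl] at h2
  zify at h1 hsum hle
  linarith

/-- Each search and sequence of slides raises the count on `{v, w}` while leaving `A` unchanged, so
it can be repeated until `ℓ + 1` is reached. -/
lemma Config.Realizes.exists_gather (hV : V(G).Finite) (hE : E(G).Finite)
    (hG : IsSparse k ℓ G) (hC : C.Realizes ℓ G A) {e₀ : β} {v w : α}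
    (he₀ : G.IsLink e₀ v w) (he₀A : e₀ ∉ A) (hvw : v ≠ w) :
    ∃ C' : Config α β k, C'.Realizes ℓ G A ∧ ℓ + 1 ≤ C'.pebblesOn v w := by
  have key : ∀ m ≤ ℓ + 1, ∃ C' : Config α β k, C'.Realizes ℓ G A ∧ m ≤ C'.pebblesOn v w := by
    intro m
    induction m with
    | zero => exact fun _ => ⟨C, hC, Nat.zero_le _⟩
    | succ m ih =>
      intro hm
      obtain ⟨C', hC', h⟩ := ih (by omega)
      by_cases hlt : m + 1 ≤ C'.pebblesOn v w
      · exact ⟨C', hC', hlt⟩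
      · obtain ⟨s, x, hs, hx, hp, hreach⟩ :=
          hC'.exists_reachable_pebble hV hE hG he₀ he₀A hvw (by omega)
        obtain ⟨n, f, h0, hn, hpath, hinj⟩ := exists_injOn_path hreach
        obtain ⟨C'', hC'', h'⟩ := hC'.gather_along hvw n f (h0 ▸ hs) (hn ▸ hx) hinj hpath
          (hn ▸ hp)
        exact ⟨C'', hC'', by omega⟩
  exact key (ℓ + 1) le_rfl

open Classical in
lemma Config.Realizes.addEdge (hC : C.Realizes ℓ G A) {e : β} {v w : α}
    (he : G.IsLink e v w) (heA : e ∉ A) (hpeb : ℓ + 1 ≤ C.pebblesOn v w)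
    (hv : 0 < (C.peb v).card) : ∃ C' : Config α β k, C'.Realizes ℓ G (insert e A) := by
  classical
  obtain ⟨c, hc⟩ := Multiset.card_pos_iff_exists_mem.1 hv
  let C' : Config α β k :=
    { arc := Function.update C.arc e (some (v, w, c))
      peb := pickUp C.peb v c }
  have hmove : Move ℓ V(G) C C' :=
    Move.addEdge C e v w c he.left_mem he.right_mem (hC.arc_eq_none heA) hpeb hc
  have harc : ∀ e', e' ≠ e → C'.arc e' = C.arc e' := fun e' h => Function.update_of_ne h _ _
  have harce : C'.arc e = some (v, w, c) := by simp [C']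
  refine ⟨C', hC.reachable.tail hmove, ?_, ?_⟩
  · intro e' x y
    by_cases h : e' = e
    · subst h
      rw [harce]
      simp only [Option.some.injEq, Prod.mk.injEq, Graph.restrict_isLink, Finset.coe_insert,
        Set.mem_insert_iff, true_or, true_and]
      rw [he.isLink_iff]
      constructor
      · rintro (⟨h1, h2⟩ | ⟨h1, h2⟩)
        · exact ⟨c, Or.inl ⟨h1, h2, rfl⟩⟩
        · exact ⟨c, Or.inr ⟨h1, h2, rfl⟩⟩
      · rintro ⟨_, ⟨h1, h2, -⟩ | ⟨h1, h2, -⟩⟩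
        · exact Or.inl ⟨h1, h2⟩
        · exact Or.inr ⟨h1, h2⟩
    · rw [harc e' h, ← hC.underlies e' x y]
      simp [h]
  · intro x hx
    have hb := hC.balance x hx
    by_cases hxv : x = v
    · subst hxv
      have h1 : C'.outEdges (insert e A) x = insert e (C.outEdges A x) := by
        ext e'
        simp only [Config.outEdges, Finset.mem_insert, Finset.mem_filter]
        by_cases h : e' = e
        · subst h
          simp [harce]
        · rw [harc e' h]
          tauto
      have h2 : e ∉ C.outEdges A x := fun h => heA (Finset.mem_filter.1 h).1
      have h3 : (C'.peb x).card + 1 = (C.peb x).card := by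
        simp only [C', pickUp, Function.update_self]
        exact Multiset.card_erase_add_one hc
      rw [h1, Finset.card_insert_of_notMem h2]
      omega
    · have h1 : C'.outEdges (insert e A) x = C.outEdges A x := by
        ext e'
        simp only [Config.outEdges, Finset.mem_insert, Finset.mem_filter]
        by_cases h : e' = e
        · subst h
          simp [harce, Ne.symm hxv, heA]
        · rw [harc e' h]
          tauto
      have h2 : C'.peb x = C.peb x := Function.update_of_ne hxv _ _
      rw [h1, h2]
      exact hb

/-- On one vertex the bound is `k - ℓ ≤ 0`. Distinct ends are needed when gathering pebbles. -/
lemma IsSparse.not_isLink_self (hkl : k ≤ ℓ) (hE : E(G).Finite) (hG : IsSparse k ℓ G) (e : β)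
    (x : α) : ¬ G.IsLink e x x := by
  intro h
  have hle : G.induce {x} ≤ G := Graph.induce_le (by simpa using h.left_mem)
  have he : e ∈ E(G.induce {x}) :=
    (show (G.induce {x}).IsLink e x x from ⟨h, rfl, rfl⟩).edge_mem
  have h1 := hG _ hle ⟨e, he⟩
  have h2 := (Set.ncard_pos (hE.subset hle.edgeSet_mono)).2 ⟨e, he⟩
  rw [show V(G.induce {x}) = {x} from rfl, Set.ncard_singleton] at h1
  omega

/-- A finite `(k, ℓ)`-sparse graph with `k ≤ ℓ` is a pebble-game graph. -/
lemma IsSparse.isPebbleGameGraph (hkl : k ≤ ℓ) (hV : V(G).Finite) (hE : E(G).Finite)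
    (hG : IsSparse k ℓ G) : IsPebbleGameGraph k ℓ G := by
  classical
  have key : ∀ A : Finset β, ↑A ⊆ E(G) → ∃ C : Config α β k, C.Realizes ℓ G A := by
    intro A
    induction A using Finset.induction_on with
    | empty => exact fun _ => ⟨_, realizes_init G⟩
    | insert e A he ih =>
      intro hA
      rw [Finset.coe_insert] at hA
      have hA' := (Set.subset_insert _ _).trans hA
      obtain ⟨C, hC⟩ := ih hA'
      obtain ⟨v, w, hl⟩ := G.exists_isLink_of_mem_edgeSet (hA (Set.mem_insert _ _))
      have hvw : v ≠ w := by
        rintro rfl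
        exact hG.not_isLink_self hkl hE e v hl
      obtain ⟨C', hC', hp⟩ := hC.exists_gather hV hE hG hl he hvw
      -- One of the ends carries a pebble, as together they carry at least `ℓ + 1`; the new arc is
      -- directed out of such an end.
      by_cases hv : 0 < (C'.peb v).card
      · exact hC'.addEdge hl he hp hv
      · have hp' := C'.pebblesOn_of_ne hvw
        refine hC'.addEdge hl.symm he ?_ (by omega)
        rw [C'.pebblesOn_of_ne hvw.symm]
        omega
  obtain ⟨C, hC⟩ := key hE.toFinset (by simp)
  refine ⟨C, hC.reachable, ?_⟩
  simpa using hC.underlies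

end GameConstruction

end PebbleGame

theorem mainTheorem4 {α β : Type*} (k ℓ : ℕ) (hkl : k ≤ ℓ) (hlk : (ℓ : ℤ) ≤ 2 * (k : ℤ) - 1)
    (G : Graph α β) (hV : V(G).Finite) (hE : E(G).Finite) :
    (PebbleGame.IsTight k ℓ G ∧ PebbleGame.IsPebbleGameGraph k ℓ G) ↔
      (PebbleGame.IsProperTreeDecomposable k ℓ G ∧ PebbleGame.HasTightCount k ℓ G) := by
  constructor
  · rintro ⟨hG, -⟩
    exact ⟨hG.isProperTreeDecomposable hkl hlk hV hE, hG.2⟩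
  · rintro ⟨hG, hcount⟩
    have hsparse := hG.isSparse hV hE
    exact ⟨⟨hsparse, hcount⟩, hsparse.isPebbleGameGraph hkl hV hE⟩
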